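/- Let $\mathsf{GLP}$ be the propositional normal modal logic with a modality $[\alpha]$ for each ordinal $\alpha$ (and $\langle\alpha\rangle=\neg[\alpha]\neg$), axiomatized by the propositional tautologies and the schemata $[\alpha](\chi\to\psi)\to([\alpha]\chi\to[\alpha]\psi)$; $[\alpha]([\alpha]\chi\to\chi)\to[\alpha]\chi$; $\langle\alpha\rangle\psi\to[\beta]\langle\alpha\rangle\psi$ for $\alpha<\beta$; $[\alpha]\psi\to[\beta]\psi$ for $\alpha\le\beta$; with modus ponens and necessitation for each $[\alpha]$. A worm is a formula $\langle\alpha_1\rangle\cdots\langle\alpha_n\rangle\top$ ($n\ge 0$), identified with the finite string $\alpha_1\cdots\alpha_n$ of ordinals. Let $S$ be the class of all worms and $S_\xi$ the class of worms all of whose modalities are at least $\xi$. For worms $A,B$ put $A<_\xi B$ if and only if $\mathsf{GLP}\vdash B\to\langle\xi\rangle A$. The $\xi$-head $h_\xi(A)\in S_\xi$ of a worm $A$ is the longest initial segment (from the left) of $A$ all of whose entries are at least $\xi$. Then for every ordinal $\xi$ the relation $<_\xi$ is well-founded on $S$ and on $S_\xi$; the recursions $$\Omega_\xi(A)=\sup\{\Omega_\xi(B)+1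 : B\in S,\ B<_\xi A\}\quad(A\in S),$$ $$o_\xi(A)=\sup\{o_\xi(B)+1 : B\in S_\xi,\ B<_\xi A\}\quad(A\in S_\xi),$$ where $\sup\varnothing=0$, define ordinals (that is, all these suprema exist); and for every worm $A$, $$\Omega_\xi(A)=o_\xi(h_\xi(A)).$$ -/

import Mathlib

universe u v

namespace TransfiniteGLP

/-- Formulas of the polymodal language with one modality `[α]` for every ordinal `α`. -/
inductive Form : Type (u + 1)
  | var : ℕ → Form
  | bot : Form
  | imp : Form → Form → Form
  | box : Ordinal.{u} → Form → Form

namespace Form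

/-- Negation. -/
def neg (φ : Form.{u}) : Form.{u} := imp φ bot

/-- Truth. -/
def top : Form.{u} := neg bot

/-- The dual modality `⟨α⟩φ`, that is, `¬[α]¬φ`. -/
def dia (α : Ordinal.{u}) (φ : Form.{u}) : Form.{u} := neg (box α (neg φ))

/-- Propositional truth under a valuation `v`, of which only the values at the variables and at the
boxed formulas are used. -/
def eval (v : Form.{u} → Prop) : Form.{u} → Prop
  | var n => v (var n)
  | bot => False
  | imp φ ψ => eval v φ → eval v ψ
  | box α φ => v (box α φ)

/-- Substitution instances of propositional tautologies. -/
def Tautology (φ : Form.{u}) : Prop := ∀ v : Form.{u} → Prop, eval v φ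

end Form

open Form in
/-- Provability in the class-size logic `GLP`. -/
inductive Provable : Form.{u} → Prop
  | taut (φ : Form.{u}) : Tautology φ → Provable φ
  | distr (α : Ordinal.{u}) (φ ψ : Form.{u}) :
      Provable (imp (box α (imp φ ψ)) (imp (box α φ) (box α ψ)))
  | loeb (α : Ordinal.{u}) (φ : Form.{u}) :
      Provable (imp (box α (imp (box α φ) φ)) (box α φ))
  | negIntro (α β : Ordinal.{u}) (φ : Form.{u}) : α < β →
      Provable (imp (dia α φ) (box β (dia α φ)))
  | monotone (α β : Ordinal.{u}) (φ : Form.{u}) : α ≤ β →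
      Provable (imp (box α φ) (box β φ))
  | mp (φ ψ : Form.{u}) : Provable (imp φ ψ) → Provable φ → Provable ψ
  | nec (α : Ordinal.{u}) (φ : Form.{u}) : Provable φ → Provable (box α φ)

/-- A worm `⟨α₁⟩…⟨αₙ⟩⊤`, given by its string of ordinals `α₁ … αₙ`. -/
abbrev Worm : Type (u + 1) := List Ordinal.{u}

/-- The formula `⟨α₁⟩…⟨αₙ⟩⊤` of a worm. -/
def Worm.toForm : Worm.{u} → Form.{u}
  | [] => Form.top
  | α :: A => Form.dia α (Worm.toForm A)

/-- `S_ξ`: the worms all of whose modalities are at least `ξ`. -/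
def S (ξ : Ordinal.{u}) : Set Worm.{u} := {A | ∀ ζ ∈ A, ξ ≤ ζ}

/-- `A <_ξ B` on all worms: `GLP ⊢ B → ⟨ξ⟩A`. -/
def LT (ξ : Ordinal.{u}) (A B : Worm.{u}) : Prop :=
  Provable (Form.imp (Worm.toForm B) (Form.dia ξ (Worm.toForm A)))

/-- The relation `<_ξ` restricted to `S_ξ`. -/
def LTS (ξ : Ordinal.{u}) (A B : S.{u} ξ) : Prop := LT ξ A.1 B.1

open Classical in
/-- The recursion `rank a = sup {rank b + 1 | r b a}` along a well-founded relation `r`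
(and `0` if `r` is not well-founded). -/
noncomputable def rank {X : Type v} (r : X → X → Prop) (a : X) : Ordinal.{u} :=
  if h : WellFounded r then
    h.fix (fun a ih => sSup {o : Ordinal.{u} | ∃ (b : X) (hb : r b a), o = ih b hb + 1}) a
  else 0

theorem rank_eq {X : Type v} {r : X → X → Prop} (h : WellFounded r) (a : X) :
    rank.{u, v} r a = sSup {o : Ordinal.{u} | ∃ b : X, r b a ∧ o = rank.{u, v} r b + 1} := by
  have key : ∀ x, rank.{u, v} r x = h.fix
      (fun a ih => sSup {o : Ordinal.{u} | ∃ (b : X) (hb : r b a), o = ih b hb + 1}) x := by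
    intro x
    simp only [rank, dif_pos h]
  rw [key, WellFounded.fix_eq]
  simp only [key, exists_prop]

/-- `o_ξ(A) = sup {o_ξ(B) + 1 | B ∈ S_ξ, B <_ξ A}`, for `A ∈ S_ξ`. -/
noncomputable def o (ξ : Ordinal.{u}) (A : S.{u} ξ) : Ordinal.{u} := rank (LTS ξ) A

/-- `Ω_ξ(A) = sup {Ω_ξ(B) + 1 | B <_ξ A}`, with `B` ranging over all worms. -/
noncomputable def Omega (ξ : Ordinal.{u}) (A : Worm.{u}) : Ordinal.{u} := rank (LT ξ) A

/-- The `ξ`-head of a worm. -/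
noncomputable def head (ξ : Ordinal.{u}) : Worm.{u} → Worm.{u}
  | [] => []
  | ζ :: A => if ξ ≤ ζ then ζ :: head ξ A else []

theorem head_mem (ξ : Ordinal.{u}) (A : Worm.{u}) : head ξ A ∈ S ξ := by
  induction A with
  | nil => simp [head, S]
  | cons ζ A ih =>
    by_cases h : ξ ≤ ζ
    · simp only [S, Set.mem_ofPred_eq] at ih ⊢
      simpa [head, h] using ih
    · simp [head, h, S]

end TransfiniteGLP

/-! A nonempty worm `h ++ μ :: b`, split at its least entry with `h` above `μ`, is implied by `h ∧
⟨μ⟩b`, because `⟨μ⟩b` passes under modalities above `μ` (`Ent.dia_conj`, `conj_ent_append`).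
Induction on length then gives linearity of `<_ξ` on `S_ξ` (`trichotomy`). Irreflexivity comes from
Löb's rule and the consistency of `⟨μ⟩⊤`, which implies every worm with entries below `μ`.

Since `<_ξ` is contained in `<_0`, well-foundedness reduces to `ξ = 0`, where accessibility is built
up along the splitting (`acc_append`). Predecessors have entries below any strict bound on those of
the given worm, so they form a small set and the suprema exist. Finally, the heads of the
predecessors of `A` are exactly the predecessors in `S_ξ` of its head, so the two recursions agree.
-/

namespace TransfiniteGLP

open Form

namespace Form

/-- Conjunction. -/
def conj (φ ψ : Form.{u}) : Form.{u} := neg (imp φ (neg ψ))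

theorem eval_neg (v : Form.{u} → Prop) (φ : Form.{u}) : eval v (neg φ) ↔ ¬ eval v φ := Iff.rfl

theorem eval_imp (v : Form.{u} → Prop) (φ ψ : Form.{u}) :
    eval v (imp φ ψ) ↔ (eval v φ → eval v ψ) := Iff.rfl

theorem eval_conj (v : Form.{u} → Prop) (φ ψ : Form.{u}) :
    eval v (conj φ ψ) ↔ eval v φ ∧ eval v ψ := by
  simp only [conj, eval_neg, eval_imp]
  tauto

end Form

/-- `GLP` proves the implication from `φ` to `ψ`. -/
def Ent (φ ψ : Form.{u}) : Prop := Provable (imp φ ψ)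

/-! ### Derived rules of `GLP` -/

section Calculus

variable {α β : Ordinal.{u}} {φ ψ χ : Form.{u}}

theorem Provable.of_taut₁ (h : Provable φ) (t : ∀ v, eval v φ → eval v ψ) : Provable ψ :=
  .mp φ ψ (.taut _ t) h

theorem Provable.of_taut₂ (h₁ : Provable φ) (h₂ : Provable ψ)
    (t : ∀ v, eval v φ → eval v ψ → eval v χ) : Provable χ :=
  .mp ψ χ (h₁.of_taut₁ (ψ := imp ψ χ) t) h₂

theorem Ent.of_eval (t : ∀ v, eval v φ → eval v ψ) : Ent φ ψ := .taut _ t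

theorem Ent.refl (φ : Form.{u}) : Ent φ φ := .of_eval fun _ h => h

theorem Ent.trans (h₁ : Ent φ ψ) (h₂ : Ent ψ χ) : Ent φ χ :=
  Provable.of_taut₂ h₁ h₂ fun _ a b c => b (a c)

theorem Ent.top (φ : Form.{u}) : Ent φ Form.top := .of_eval fun _ _ h => h

theorem Ent.conj_left (φ ψ : Form.{u}) : Ent (conj φ ψ) φ :=
  .of_eval fun v h => ((eval_conj v φ ψ).1 h).1

theorem Ent.conj_right (φ ψ : Form.{u}) : Ent (conj φ ψ) ψ :=
  .of_eval fun v h => ((eval_conj v φ ψ).1 h).2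

theorem Ent.conj_intro (h₁ : Ent φ ψ) (h₂ : Ent φ χ) : Ent φ (conj ψ χ) :=
  Provable.of_taut₂ h₁ h₂ fun v a b c => (eval_conj v ψ χ).2 ⟨a c, b c⟩

theorem Ent.contrapose (h : Ent φ ψ) : Ent (neg ψ) (neg φ) :=
  Provable.of_taut₁ h fun _ a b c => b (a c)

theorem Ent.box (h : Ent φ ψ) : Ent (box α φ) (box α ψ) :=
  .mp _ _ (.distr α φ ψ) (.nec α _ h)

theorem Ent.box_box (α : Ordinal.{u}) (φ : Form.{u}) :
    Ent (Form.box α φ) (Form.box α (Form.box α φ)) := by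
  -- Transitivity comes from Löb's axiom for `φ ∧ [α]φ`.
  have h₁ : Ent (Form.box α (conj φ (Form.box α φ))) (Form.box α φ) := (Ent.conj_left _ _).box
  have h₂ : Ent φ (imp (Form.box α (conj φ (Form.box α φ))) (conj φ (Form.box α φ))) :=
    Provable.of_taut₁ h₁ fun v a b c => (eval_conj v _ _).2 ⟨b, a c⟩
  exact (h₂.box.trans (.loeb α _)).trans (Ent.conj_right _ _).box

theorem Ent.dia (hαβ : α ≤ β) (h : Ent φ ψ) : Ent (dia β φ) (dia α ψ) :=
  (Ent.contrapose (h.contrapose.box)).trans (Ent.contrapose (.monotone α β _ hαβ))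

theorem Ent.dia_dia (α : Ordinal.{u}) (φ : Form.{u}) :
    Ent (Form.dia α (Form.dia α φ)) (Form.dia α φ) :=
  Ent.contrapose ((Ent.box_box α (neg φ)).trans
    (Ent.box (Ent.of_eval fun _ a b => b a)))

theorem Ent.dia_conj (hαβ : α < β) (φ ψ : Form.{u}) :
    Ent (conj (Form.dia β φ) (Form.dia α ψ)) (Form.dia β (conj φ (Form.dia α ψ))) := by
  have h₁ : Ent (Form.dia α ψ) (Form.box β (Form.dia α ψ)) := .negIntro α β ψ hαβ
  have h₂ : Ent (neg (conj φ (Form.dia α ψ))) (imp (Form.dia α ψ) (neg φ)) :=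
    .of_eval fun v a b c => a ((eval_conj v _ _).2 ⟨c, b⟩)
  have h₃ : Ent (Form.box β (neg (conj φ (Form.dia α ψ))))
      (imp (Form.box β (Form.dia α ψ)) (Form.box β (neg φ))) := h₂.box.trans (.distr _ _ _)
  refine Provable.of_taut₂ h₁ h₃ fun v a b c d => ?_
  rw [eval_conj] at c
  exact c.1 (b d (a c.2))

theorem Ent.neg_of_dia (h : Ent φ (Form.dia α φ)) : Provable (neg φ) := by
  have h₁ : Ent (Form.box α (neg φ)) (neg φ) := Provable.of_taut₁ h fun _ a b c => a c b
  exact .mp _ _ h₁ (.mp _ _ (.loeb α _) (.nec α _ h₁))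

end Calculus

/-! ### Consistency of `⟨α⟩⊤` -/

section Consistency

/-- Derivability in `GLP` from the hypotheses `Γ`, without necessitation of hypotheses. -/
inductive Derivable (Γ : Form.{u} → Prop) : Form.{u} → Prop
  | provable (φ : Form.{u}) : Provable φ → Derivable Γ φ
  | hyp (φ : Form.{u}) : Γ φ → Derivable Γ φ
  | mp (φ ψ : Form.{u}) : Derivable Γ (imp φ ψ) → Derivable Γ φ → Derivable Γ ψ

/-- `[α]φ` is true if `φ` is derivable in `GLP` from the true formulas of the forms
`[β]ψ` and `¬[β]ψ` with `β < α`. -/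
def TrueBox (α : Ordinal.{u}) : Form.{u} → Prop :=
  Derivable fun δ => ∃ (β : Ordinal.{u}) (_ : β < α) (ψ : Form.{u}),
    (δ = box β ψ ∧ TrueBox β ψ) ∨ (δ = neg (box β ψ) ∧ ¬ TrueBox β ψ)
termination_by α

/-- The true formulas of the forms `[β]ψ` and `¬[β]ψ` with `β < α`. -/
def TrueLiteral (α : Ordinal.{u}) (δ : Form.{u}) : Prop :=
  ∃ (β : Ordinal.{u}) (_ : β < α) (ψ : Form.{u}),
    (δ = box β ψ ∧ TrueBox β ψ) ∨ (δ = neg (box β ψ) ∧ ¬ TrueBox β ψ)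

theorem trueBox_iff (α : Ordinal.{u}) (φ : Form.{u}) :
    TrueBox α φ ↔ Derivable (TrueLiteral α) φ := by
  rw [TrueBox]
  rfl

/-- Positive literals use transitivity, negative ones negative introspection. This closes the
derivable formulas under necessitation, which validates Löb's axiom. -/
theorem TrueLiteral.box {α : Ordinal.{u}} {δ : Form.{u}} (h : TrueLiteral α δ) :
    Ent δ (box α δ) := by
  obtain ⟨β, hβ, ψ, ⟨rfl, -⟩ | ⟨rfl, -⟩⟩ := h
  · exact (Ent.box_box β ψ).trans (.monotone β α _ hβ.le)
  · have h₁ : Ent (neg (Form.box β ψ)) (dia β (neg ψ)) :=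
      Ent.contrapose (Ent.box (Ent.of_eval fun v a => not_not.1 a))
    have h₂ : Ent (dia β (neg ψ)) (neg (Form.box β ψ)) :=
      Ent.contrapose (Ent.box (Ent.of_eval fun v a b => b a))
    exact (h₁.trans (.negIntro β α _ hβ)).trans h₂.box

theorem Derivable.box {α : Ordinal.{u}} {φ : Form.{u}} (h : Derivable (TrueLiteral α) φ) :
    Derivable (TrueLiteral α) (box α φ) := by
  induction h with
  | provable φ h => exact .provable _ (.nec α φ h)
  | hyp φ h => exact .mp _ _ (.provable _ h.box) (.hyp _ h)
  | mp φ ψ _ _ ih₁ ih₂ => exact .mp _ _ (.mp _ _ (.provable _ (.distr α φ ψ)) ih₁) ih₂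

/-- The valuation given by `TrueBox`. -/
def truth : Form.{u} → Prop
  | box α φ => TrueBox α φ
  | _ => False

theorem eval_truth_box (α : Ordinal.{u}) (φ : Form.{u}) :
    eval truth (box α φ) ↔ Derivable (TrueLiteral α) φ := trueBox_iff α φ

theorem TrueLiteral.mono {α β : Ordinal.{u}} (h : α ≤ β) {δ : Form.{u}}
    (hδ : TrueLiteral α δ) : TrueLiteral β δ := by
  obtain ⟨γ, hγ, r⟩ := hδ
  exact ⟨γ, hγ.trans_le h, r⟩

theorem Derivable.mono {Γ Δ : Form.{u} → Prop} (h : ∀ δ, Γ δ → Δ δ) {φ : Form.{u}}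
    (hφ : Derivable Γ φ) : Derivable Δ φ := by
  induction hφ with
  | provable φ h => exact .provable _ h
  | hyp φ hφ => exact .hyp _ (h _ hφ)
  | mp φ ψ _ _ ih₁ ih₂ => exact .mp _ _ ih₁ ih₂

theorem Provable.eval_truth {φ : Form.{u}} (h : Provable φ) : eval truth φ := by
  induction h with
  | taut φ h => exact h _
  | distr α φ ψ =>
    intro h₁ h₂
    rw [eval_truth_box] at *
    exact .mp _ _ h₁ h₂
  | loeb α φ =>
    intro h
    rw [eval_truth_box] at *
    exact .mp _ _ h (.mp _ _ (.provable _ (.loeb α φ)) h.box)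
  | negIntro α β φ h =>
    intro h₁
    rw [eval_truth_box]
    exact .hyp _ ⟨α, h, _, .inr ⟨rfl, h₁⟩⟩
  | monotone α β φ h =>
    intro h₁
    rw [eval_truth_box] at *
    exact h₁.mono fun _ => TrueLiteral.mono h
  | mp φ ψ _ _ ih₁ ih₂ => exact ih₁ ih₂
  | nec α φ h _ =>
    rw [eval_truth_box]
    exact .provable _ h

theorem TrueLiteral.eval_truth {α : Ordinal.{u}} {δ : Form.{u}} (h : TrueLiteral α δ) :
    eval truth δ := by
  obtain ⟨β, hβ, ψ, ⟨rfl, h⟩ | ⟨rfl, h⟩⟩ := h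
  · exact h
  · exact h

theorem Derivable.eval_truth {α : Ordinal.{u}} {φ : Form.{u}}
    (h : Derivable (TrueLiteral α) φ) : eval truth φ := by
  induction h with
  | provable φ h => exact h.eval_truth
  | hyp φ h => exact h.eval_truth
  | mp φ ψ _ _ ih₁ ih₂ => exact ih₁ ih₂

theorem not_provable_neg_dia_top (α : Ordinal.{u}) : ¬ Provable (neg (dia α Form.top)) := by
  intro h
  refine h.eval_truth fun h₁ => ?_
  have h₂ := (eval_truth_box _ _).1 h₁
  exact h₂.eval_truth fun a => a

end Consistency

/-! ### Linearity of the worm orders -/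

section Worms

open Worm

variable {ξ μ ν : Ordinal.{u}} {A B C h b : Worm.{u}}

theorem LT.mono (hμν : μ ≤ ν) (h : LT ν A B) : LT μ A B :=
  Ent.trans h (Ent.dia hμν (.refl _))

theorem LT.of_ent_left (h : LT ξ A B) (h' : Ent A.toForm C.toForm) : LT ξ C B :=
  Ent.trans h (Ent.dia le_rfl h')

theorem LT.of_ent_right (h : LT ξ A B) (h' : Ent C.toForm B.toForm) : LT ξ A C :=
  Ent.trans h' h

theorem LT.trans (h₁ : LT ξ A B) (h₂ : LT ξ B C) : LT ξ A C :=
  (Ent.trans h₂ (Ent.dia le_rfl h₁)).trans (Ent.dia_dia ξ _)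

theorem S_anti (h : μ ≤ ν) : S ν ⊆ S μ := fun _ hA ζ hζ => h.trans (hA ζ hζ)

theorem mem_S_cons {ζ : Ordinal.{u}} : ζ :: A ∈ S ξ ↔ ξ ≤ ζ ∧ A ∈ S ξ := List.forall_mem_cons

theorem mem_S_append : A ++ B ∈ S ξ ↔ A ∈ S ξ ∧ B ∈ S ξ := List.forall_mem_append

theorem mem_S_zero (A : Worm.{u}) : A ∈ S 0 := fun _ _ => zero_le

theorem nil_mem_S : ([] : Worm.{u}) ∈ S ξ := by simp [S]

/-- The worm is built from the right: each suffix already obtained moves under `⟨μ⟩`, which is then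
weakened to the next entry. -/
theorem ent_dia_top_of_lt (A : Worm.{u}) (hA : ∀ ζ ∈ A, ζ < μ) :
    Ent (dia μ Form.top) A.toForm := by
  induction A with
  | nil => exact .top _
  | cons a A ih =>
    rw [List.forall_mem_cons] at hA
    have h₁ := ih hA.2
    cases A with
    | nil => exact Ent.dia hA.1.le (.refl _)
    | cons c A =>
      have h₂ := Ent.dia_conj (hA.2 c (by simp)) Form.top (toForm A)
      exact ((Ent.refl _).conj_intro h₁).trans
        (h₂.trans (Ent.dia hA.1.le (Ent.conj_right _ _)))

theorem exists_forall_lt (A : Worm.{u}) : ∃ μ : Ordinal.{u}, ∀ ζ ∈ A, ζ < μ := by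
  induction A with
  | nil => exact ⟨0, by simp⟩
  | cons a A ih =>
    obtain ⟨μ, hμ⟩ := ih
    refine ⟨max μ (Order.succ a), ?_⟩
    rw [List.forall_mem_cons]
    exact ⟨lt_max_of_lt_right (Order.lt_succ a), fun ζ hζ => lt_max_of_lt_left (hμ ζ hζ)⟩

theorem not_LT_self (ξ : Ordinal.{u}) (A : Worm.{u}) : ¬ LT ξ A A := by
  intro h
  obtain ⟨μ, hμ⟩ := exists_forall_lt A
  exact not_provable_neg_dia_top μ
    (Provable.of_taut₂ (ent_dia_top_of_lt A hμ) (Ent.neg_of_dia h) fun _ a b c => b (a c))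

theorem ent_append_left (h R : Worm.{u}) : Ent (toForm (h ++ R)) (toForm h) := by
  induction h with
  | nil => exact .top _
  | cons a h ih => exact Ent.dia le_rfl ih

theorem ent_append_cons (hb : h ∈ S μ) : Ent (toForm (h ++ μ :: b)) (dia μ b.toForm) := by
  induction h with
  | nil => exact .refl _
  | cons a h ih =>
    rw [mem_S_cons] at hb
    exact (Ent.dia hb.1 (ih hb.2)).trans (Ent.dia_dia μ _)

theorem conj_ent_append (hA : h ∈ S (Order.succ μ)) :
    Ent (conj (toForm h) (dia μ b.toForm)) (toForm (h ++ μ :: b)) := by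
  induction h with
  | nil => exact Ent.conj_right _ _
  | cons a h ih =>
    rw [mem_S_cons] at hA
    exact (Ent.dia_conj (Order.succ_le_iff.1 hA.1) _ _).trans (Ent.dia le_rfl (ih hA.2))

theorem ent_append_of_ent (hA : h ∈ S (Order.succ μ)) (h₁ : Ent B.toForm h.toForm)
    (h₂ : LT μ b B) : Ent B.toForm (toForm (h ++ μ :: b)) :=
  (h₁.conj_intro h₂).trans (conj_ent_append hA)

theorem LT_append_of_LT (hA : h ∈ S (Order.succ μ)) (h₁ : LT (Order.succ μ) h B)
    (h₂ : LT μ b B) : LT (Order.succ μ) (h ++ μ :: b) B :=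
  ((Ent.conj_intro h₁ h₂).trans (Ent.dia_conj (Order.lt_succ μ) _ _)).trans
    (Ent.dia le_rfl (conj_ent_append hA))

theorem LT_append_of_LT_or_ent (hA : h ∈ S μ)
    (h₁ : LT μ B b ∨ Ent b.toForm B.toForm) : LT μ B (h ++ μ :: b) := by
  have h₂ : LT μ b (h ++ μ :: b) := ent_append_cons hA
  exact h₁.elim (fun h₁ => h₁.trans h₂) (fun h₁ => h₂.of_ent_left h₁)

/-- A nonempty worm splits at the first occurrence of its least entry. -/
theorem exists_eq_append (hA : A ≠ []) (hξ : A ∈ S ξ) : ∃ (μ : Ordinal.{u}) (h b : Worm.{u}),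
    A = h ++ μ :: b ∧ ξ ≤ μ ∧ h ∈ S (Order.succ μ) ∧ b ∈ S μ := by
  induction A with
  | nil => exact absurd rfl hA
  | cons a A ih =>
    rw [mem_S_cons] at hξ
    by_cases hA' : A = []
    · subst hA'
      exact ⟨a, [], [], rfl, hξ.1, nil_mem_S, nil_mem_S⟩
    obtain ⟨μ, h, b, rfl, h₁, h₂, h₃⟩ := ih hA' hξ.2
    rcases lt_or_ge μ a with hμ | hμ
    · exact ⟨μ, a :: h, b, rfl, h₁, mem_S_cons.2 ⟨Order.succ_le_of_lt hμ, h₂⟩, h₃⟩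
    · refine ⟨a, [], h ++ μ :: b, rfl, hξ.1, nil_mem_S, ?_⟩
      rw [mem_S_append, mem_S_cons]
      exact ⟨S_anti (hμ.trans (Order.le_succ μ)) h₂, hμ, S_anti hμ h₃⟩

theorem LT_nil_of_ne_nil (hA : A ≠ []) (hξ : A ∈ S ξ) : LT ξ [] A := by
  cases A with
  | nil => exact absurd rfl hA
  | cons a A => exact Ent.dia (mem_S_cons.1 hξ).1 (.top _)

/-- The order `<_ξ` is linear on `S_ξ` up to provable equivalence. -/
theorem trichotomy (n : ℕ) : ∀ {ξ : Ordinal.{u}} {A B : Worm.{u}}, A.length + B.length ≤ n →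
    A ∈ S ξ → B ∈ S ξ →
    LT ξ A B ∨ (Ent A.toForm B.toForm ∧ Ent B.toForm A.toForm) ∨ LT ξ B A := by
  induction n with
  | zero =>
    intro ξ A B hn _ _
    obtain rfl : A = [] := List.length_eq_zero_iff.1 (by omega)
    obtain rfl : B = [] := List.length_eq_zero_iff.1 (by omega)
    exact .inr (.inl ⟨.refl _, .refl _⟩)
  | succ n ih =>
    -- The case of different least entries: `B` lies wholly above `μ`. Either `b` reaches `B`, or
    -- `h` and `B` are compared at level `μ + 1`.
    have key : ∀ {μ : Ordinal.{u}} {h b B : Worm.{u}}, h.length + 1 + b.length + B.length ≤ n + 1 →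
        h ∈ S (Order.succ μ) → b ∈ S μ → B ∈ S (Order.succ μ) →
        LT μ (h ++ μ :: b) B ∨
          (Ent (toForm (h ++ μ :: b)) B.toForm ∧ Ent B.toForm (toForm (h ++ μ :: b))) ∨
          LT μ B (h ++ μ :: b) := by
      intro μ h b B hn hh hb hB
      have hle : μ ≤ Order.succ μ := Order.le_succ μ
      rcases ih (by omega) hb (S_anti hle hB) with h₁ | h₁ | h₁
      · rcases ih (by omega) hh hB with h₂ | h₂ | h₂
        · exact .inl ((LT_append_of_LT hh h₂ h₁).mono hle)
        · exact .inr (.inl ⟨(ent_append_left _ _).trans h₂.1, ent_append_of_ent hh h₂.2 h₁⟩)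
        · exact .inr (.inr ((h₂.of_ent_right (ent_append_left _ _)).mono hle))
      · exact .inr (.inr (LT_append_of_LT_or_ent (S_anti hle hh) (.inr h₁.1)))
      · exact .inr (.inr (LT_append_of_LT_or_ent (S_anti hle hh) (.inl h₁)))
    intro ξ A B hn hA hB
    by_cases hA' : A = []
    · by_cases hB' : B = []
      · subst hA' hB'
        exact .inr (.inl ⟨.refl _, .refl _⟩)
      · subst hA'
        exact .inl (LT_nil_of_ne_nil hB' hB)
    by_cases hB' : B = []
    · subst hB'
      exact .inr (.inr (LT_nil_of_ne_nil hA' hA))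
    obtain ⟨μ, h, b, rfl, hξ, hh, hb⟩ := exists_eq_append hA' hA
    obtain ⟨ν, k, c, rfl, hξ', hk, hc⟩ := exists_eq_append hB' hB
    simp only [List.length_append, List.length_cons] at hn
    rcases lt_trichotomy μ ν with hμν | rfl | hμν
    · have hS : k ++ ν :: c ∈ S (Order.succ μ) := by
        rw [mem_S_append, mem_S_cons]
        have h₁ := Order.succ_le_of_lt hμν
        exact ⟨S_anti (h₁.trans (Order.le_succ ν)) hk, h₁, S_anti h₁ hc⟩
      have h₁ := key (by simp only [List.length_append, List.length_cons]; omega) hh hb hS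
      exact h₁.imp (·.mono hξ) (·.imp_right (·.mono hξ))
    · have hle : μ ≤ Order.succ μ := Order.le_succ μ
      have hSA : h ++ μ :: b ∈ S μ :=
        mem_S_append.2 ⟨S_anti hle hh, mem_S_cons.2 ⟨le_rfl, hb⟩⟩
      have hSB : k ++ μ :: c ∈ S μ :=
        mem_S_append.2 ⟨S_anti hle hk, mem_S_cons.2 ⟨le_rfl, hc⟩⟩
      rcases ih (by simp only [List.length_append, List.length_cons]; omega) hb hSB
        with h₁ | h₁ | h₁
      · rcases ih (by simp only [List.length_append, List.length_cons]; omega) hc hSA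
          with h₂ | h₂ | h₂
        -- Each tail lies below the other worm, so the parts above `μ` decide.
        · rcases ih (by omega) hh hk with h₃ | h₃ | h₃
          · exact .inl ((LT_append_of_LT hh (h₃.of_ent_right (ent_append_left _ _)) h₁).mono
              (hξ.trans hle))
          · exact .inr (.inl ⟨ent_append_of_ent hk ((ent_append_left _ _).trans h₃.1) h₂,
              ent_append_of_ent hh ((ent_append_left _ _).trans h₃.2) h₁⟩)
          · exact .inr (.inr ((LT_append_of_LT hk (h₃.of_ent_right (ent_append_left _ _)) h₂).mono
              (hξ.trans hle)))
        · exact .inl ((LT_append_of_LT_or_ent (S_anti hle hk) (.inr h₂.1)).mono hξ)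
        · exact .inl ((LT_append_of_LT_or_ent (S_anti hle hk) (.inl h₂)).mono hξ)
      · exact .inr (.inr ((LT_append_of_LT_or_ent (S_anti hle hh) (.inr h₁.1)).mono hξ))
      · exact .inr (.inr ((LT_append_of_LT_or_ent (S_anti hle hh) (.inl h₁)).mono hξ))
    · have hS : h ++ μ :: b ∈ S (Order.succ ν) := by
        rw [mem_S_append, mem_S_cons]
        have h₁ := Order.succ_le_of_lt hμν
        exact ⟨S_anti (h₁.trans (Order.le_succ μ)) hh, h₁, S_anti h₁ hb⟩
      rcases key (by simp only [List.length_append, List.length_cons]; omega) hk hc hS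
        with h₁ | h₁ | h₁
      · exact .inr (.inr (h₁.mono hξ'))
      · exact .inr (.inl h₁.symm)
      · exact .inl (h₁.mono hξ')

theorem LT_trichotomy (hA : A ∈ S ξ) (hB : B ∈ S ξ) :
    LT ξ A B ∨ (Ent A.toForm B.toForm ∧ Ent B.toForm A.toForm) ∨ LT ξ B A :=
  trichotomy _ le_rfl hA hB

end Worms

/-! ### Well-foundedness -/

section WellFoundedness

open Worm

variable {ξ μ ν : Ordinal.{u}} {A B C h b : Worm.{u}}

theorem acc_of_ent (hA : Acc (LT 0) A) (h : Ent A.toForm B.toForm) : Acc (LT 0) B :=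
  .intro _ fun _ hC => hA.inv (hC.of_ent_right h)

theorem acc_nil : Acc (LT 0) ([] : Worm.{u}) :=
  .intro _ fun _ hC => absurd (hC.of_ent_left (C := []) (.top _)) (not_LT_self 0 _)

/-- Accessibility passes from the two parts of a worm around its least entry to the worm. -/
theorem acc_append (μ : Ordinal.{u}) : ∀ {h : Worm.{u}}, Acc (LT 0) h → h ∈ S (Order.succ μ) →
    ∀ {b : Worm.{u}}, Acc (LT 0) b → b ∈ S μ → Acc (LT 0) (h ++ μ :: b) := by
  induction μ using WellFoundedLT.induction with | ind μ ihμ => ?_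
  intro h hacc
  induction hacc with | intro h hacc ihh => ?_
  intro hh b hb hbS
  have hle : μ ≤ Order.succ μ := Order.le_succ μ
  refine .intro _ fun C hC => ?_
  -- Both parts of `C` lie below the same worm and are shorter, so this induction makes them
  -- accessible.
  induction hn : C.length using Nat.strong_induction_on generalizing C with | _ _ ihn => ?_
  subst hn
  by_cases hC' : C = []
  · exact hC' ▸ acc_nil
  obtain ⟨ν, k, c, rfl, -, hk, hc⟩ := exists_eq_append hC' (mem_S_zero C)
  have hkacc : Acc (LT 0) k :=
    ihn _ (by simp only [List.length_append, List.length_cons]; omega) k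
      (hC.of_ent_left (ent_append_left _ _)) rfl
  have hcacc : Acc (LT 0) c := by
    refine ihn _ (by simp only [List.length_append, List.length_cons]; omega) c ?_ rfl
    exact ((LT_append_of_LT_or_ent (S_anti (Order.le_succ ν) hk) (.inr (.refl _))).mono
      zero_le).trans hC
  rcases lt_or_ge ν μ with hν | hν
  · exact ihμ ν hν hkacc hk hcacc hc
  have hCS : k ++ ν :: c ∈ S μ := mem_S_append.2
    ⟨S_anti (hν.trans (Order.le_succ ν)) hk, mem_S_cons.2 ⟨hν, S_anti hν hc⟩⟩
  rcases LT_trichotomy hbS hCS with h₁ | h₁ | h₁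
  -- With `b` below `C`, if `h` were equivalent to or below `k'`, then `C` would imply `h ++ μ :: b`
  -- or place it below itself, against `hC` and irreflexivity.
  · have main : ∀ {k' : Worm.{u}}, Ent (toForm (k ++ ν :: c)) k'.toForm → k' ∈ S (Order.succ μ) →
        LT (Order.succ μ) k' h := by
      intro k' h₂ hk'
      rcases LT_trichotomy hh hk' with h₃ | h₃ | h₃
      · exact absurd (hC.trans ((LT_append_of_LT hh (h₃.of_ent_right h₂) h₁).mono zero_le))
          (not_LT_self _ _)
      · exact absurd (hC.of_ent_left (ent_append_of_ent hh (h₂.trans h₃.2) h₁))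
          (not_LT_self _ _)
      · exact h₃
    -- If the least entry of `C` is `μ`, its first part drops below `h`; otherwise `C` itself does.
    rcases hν.eq_or_lt with rfl | hν
    · exact ihh k ((main (ent_append_left _ _) hk).mono zero_le) hk hcacc hc
    · have hν' := Order.succ_le_of_lt hν
      refine hacc _ ((main (.refl _) ?_).mono zero_le)
      exact mem_S_append.2 ⟨S_anti (hν'.trans (Order.le_succ ν)) hk,
        mem_S_cons.2 ⟨hν', S_anti hν' hc⟩⟩
  · exact acc_of_ent hb h₁.1
  · exact hb.inv (h₁.mono zero_le)

theorem acc_worm (A : Worm.{u}) : Acc (LT 0) A := by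
  induction hn : A.length using Nat.strong_induction_on generalizing A with | _ n ih => ?_
  subst hn
  by_cases hA : A = []
  · exact hA ▸ acc_nil
  obtain ⟨μ, h, b, rfl, -, hh, hb⟩ := exists_eq_append hA (mem_S_zero A)
  simp only [List.length_append, List.length_cons] at ih
  exact acc_append μ (ih _ (by omega) h rfl) hh (ih _ (by omega) b rfl) hb

theorem wellFounded_LT (ξ : Ordinal.{u}) : WellFounded (LT ξ) :=
  ⟨fun A => Subrelation.accessible (fun h => h.mono zero_le) (acc_worm A)⟩

theorem wellFounded_LTS (ξ : Ordinal.{u}) : WellFounded (LTS ξ) :=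
  InvImage.wf Subtype.val (wellFounded_LT ξ)

end WellFoundedness

/-! ### Existence of the suprema -/

section Suprema

open Worm

variable {ξ μ : Ordinal.{u}} {A B : Worm.{u}}

theorem dia_ent_dia_dia_top {ζ : Ordinal.{u}} (hB : ζ ∈ B) :
    Ent (dia 0 B.toForm) (dia 0 (dia ζ Form.top)) := by
  induction B with
  | nil => simp at hB
  | cons c B ih =>
    rcases List.mem_cons.1 hB with rfl | hB
    · exact Ent.dia le_rfl (Ent.dia le_rfl (.top _))
    · exact ((Ent.dia le_rfl (Ent.dia zero_le (.refl _))).trans (Ent.dia_dia 0 _)).trans (ih hB)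

/-- An entry `ζ ≥ μ` of `B` would give `A → ⟨0⟩⟨ζ⟩⊤`, while `⟨ζ⟩⊤` implies `A`; so `A <_0 A`. -/
theorem LT.forall_lt (h : LT ξ B A) (hA : ∀ ζ ∈ A, ζ < μ) : ∀ ζ ∈ B, ζ < μ := by
  intro ζ hζ
  by_contra hμ
  rw [not_lt] at hμ
  refine not_LT_self 0 A ((Ent.trans (h.mono zero_le) (dia_ent_dia_dia_top hζ)).trans ?_)
  exact Ent.dia le_rfl (ent_dia_top_of_lt A fun η hη => (hA η hη).trans_le hμ)

theorem small_LT (ξ : Ordinal.{u}) (A : Worm.{u}) : Small.{u} {B : Worm.{u} | LT ξ B A} := by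
  obtain ⟨μ, hμ⟩ := exists_forall_lt A
  have hsub : {B : Worm.{u} | LT ξ B A} ⊆
      Set.range (List.map (Subtype.val : Set.Iio μ → Ordinal.{u})) := by
    intro B hB
    rw [Set.range_list_map_coe]
    exact LT.forall_lt hB hμ
  exact small_subset hsub

theorem isLUB_Omega (ξ : Ordinal.{u}) (A : Worm.{u}) :
    IsLUB {γ : Ordinal.{u} | ∃ B : Worm.{u}, LT ξ B A ∧ γ = Omega ξ B + 1} (Omega ξ A) := by
  rw [Omega, rank_eq (wellFounded_LT ξ)]
  refine isLUB_csSup' ?_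
  have := small_LT ξ A
  refine (Ordinal.bddAbove_of_small
    (s := (fun B => Omega ξ B + 1) '' {B : Worm.{u} | LT ξ B A})).mono ?_
  rintro _ ⟨B, hB, rfl⟩
  exact ⟨B, hB, rfl⟩

theorem isLUB_o (ξ : Ordinal.{u}) (A : S.{u} ξ) :
    IsLUB {γ : Ordinal.{u} | ∃ B : S.{u} ξ, LTS ξ B A ∧ γ = o ξ B + 1} (o ξ A) := by
  rw [o, rank_eq (wellFounded_LTS ξ)]
  refine isLUB_csSup' ?_
  have := small_LT ξ A.1
  have : Small.{u} {B : S.{u} ξ | LTS ξ B A} :=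
    small_of_injective (β := {B : Worm.{u} | LT ξ B A.1}) (f := fun B => ⟨B.1.1, B.2⟩)
      fun B C h => Subtype.ext (Subtype.ext (Subtype.mk.inj h))
  refine (Ordinal.bddAbove_of_small
    (s := (fun B => o ξ B + 1) '' {B : S.{u} ξ | LTS ξ B A})).mono ?_
  rintro _ ⟨B, hB, rfl⟩
  exact ⟨B, hB, rfl⟩

end Suprema

/-! ### Reduction to the head -/

section Head

open Worm

variable {ξ : Ordinal.{u}} {A B C : Worm.{u}}

/-- A worm is its `ξ`-head, possibly followed by an entry below `ξ` and a worm. -/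
theorem head_eq_or (ξ : Ordinal.{u}) (A : Worm.{u}) : A = head ξ A ∨
    ∃ (μ : Ordinal.{u}) (b : Worm.{u}), μ < ξ ∧ A = head ξ A ++ μ :: b := by
  induction A with
  | nil => exact .inl rfl
  | cons a A ih =>
    by_cases ha : ξ ≤ a
    · rw [head, if_pos ha]
      refine ih.imp (congrArg _) ?_
      rintro ⟨μ, b, hμ, h⟩
      exact ⟨μ, b, hμ, congrArg (a :: ·) h⟩
    · rw [head, if_neg ha]
      exact .inr ⟨a, A, not_le.1 ha, rfl⟩

theorem head_eq_self (hA : A ∈ S ξ) : head ξ A = A := by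
  induction A with
  | nil => rfl
  | cons a A ih =>
    rw [mem_S_cons] at hA
    rw [head, if_pos hA.1, ih hA.2]

theorem head_append_cons {μ : Ordinal.{u}} (hA : A ∈ S ξ) (hμ : μ < ξ) :
    head ξ (A ++ μ :: B) = A := by
  induction A with
  | nil => rw [List.nil_append, head, if_neg hμ.not_ge]
  | cons a A ih =>
    rw [mem_S_cons] at hA
    rw [List.cons_append, head, if_pos hA.1, ih hA.2]

theorem ent_head (ξ : Ordinal.{u}) (A : Worm.{u}) : Ent A.toForm (head ξ A).toForm := by
  rcases head_eq_or ξ A with h | ⟨μ, b, -, h⟩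
  · rw [← h]
    exact .refl _
  · conv_lhs => rw [h]
    exact ent_append_left _ _

theorem LT.head (h : LT ξ B A) : LT ξ (head ξ B) (head ξ A) := by
  have h₁ : LT ξ (TransfiniteGLP.head ξ B) A := h.of_ent_left (ent_head ξ B)
  -- Otherwise the rest of `A`, which begins below `ξ`, could be moved under `⟨ξ⟩` and rejoined to
  -- the head, giving `A <_ξ A`.
  have key : ¬ LT ξ (TransfiniteGLP.head ξ A) A := by
    intro h₂
    rcases head_eq_or ξ A with h₃ | ⟨μ, b, hμ, h₃⟩
    · rw [← h₃] at h₂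
      exact not_LT_self _ _ h₂
    · have hS := S_anti (Order.succ_le_of_lt hμ) (head_mem ξ A)
      have h₄ : Ent A.toForm (dia μ b.toForm) := by
        conv_lhs => rw [h₃]
        exact ent_append_cons (S_anti hμ.le (head_mem ξ A))
      have h₅ : LT ξ A A := by
        have h₆ := ((Ent.conj_intro h₂ h₄).trans (Ent.dia_conj hμ _ _)).trans
          (Ent.dia le_rfl (conj_ent_append hS))
        rw [← h₃] at h₆
        exact h₆
      exact not_LT_self _ _ h₅
  rcases LT_trichotomy (head_mem ξ B) (head_mem ξ A) with h₂ | h₂ | h₂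
  · exact h₂
  · exact absurd (h₁.of_ent_left h₂.1) key
  · exact absurd (h₂.trans h₁) key

theorem exists_LT_of_LT_head (hC : C ∈ S ξ) (h : LT ξ C (head ξ A)) :
    ∃ B : Worm.{u}, LT ξ B A ∧ head ξ B = C := by
  have h₁ : LT ξ C A := h.of_ent_right (ent_head ξ A)
  rcases head_eq_or ξ A with h₂ | ⟨μ, b, hμ, h₂⟩
  · exact ⟨C, h₁, head_eq_self hC⟩
  -- The witness replaces the head of `A` by `C` and keeps the rest.
  · refine ⟨C ++ μ :: b, ?_, head_append_cons hC hμ⟩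
    have h₄ : Ent A.toForm (dia μ b.toForm) := by
      conv_lhs => rw [h₂]
      exact ent_append_cons (S_anti hμ.le (head_mem ξ A))
    exact ((Ent.conj_intro h₁ h₄).trans (Ent.dia_conj hμ _ _)).trans
      (Ent.dia le_rfl (conj_ent_append (S_anti (Order.succ_le_of_lt hμ) hC)))

theorem Omega_eq_o_head (ξ : Ordinal.{u}) (A : Worm.{u}) :
    Omega ξ A = o ξ ⟨head ξ A, head_mem ξ A⟩ := by
  induction A using (wellFounded_LT ξ).induction with | _ A ih => ?_
  refine (isLUB_Omega ξ A).unique ?_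
  convert isLUB_o ξ ⟨head ξ A, head_mem ξ A⟩ using 1
  ext γ
  constructor
  · rintro ⟨B, hB, rfl⟩
    exact ⟨⟨head ξ B, head_mem ξ B⟩, hB.head, by rw [ih B hB]⟩
  · rintro ⟨⟨C, hC⟩, hCA, rfl⟩
    obtain ⟨B, hB, rfl⟩ := exists_LT_of_LT_head hC hCA
    exact ⟨B, hB, by rw [ih B hB]⟩

end Head

end TransfiniteGLP

/-- The first four parts say that the recursions for `Ω_ξ` and `o_ξ` are well defined: both
relations are well-founded, and the suprema exist as ordinals. -/
theorem mainTheorem8 (ξ : Ordinal.{u}) :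
    WellFounded (TransfiniteGLP.LT ξ) ∧
    WellFounded (TransfiniteGLP.LTS ξ) ∧
    (∀ A : TransfiniteGLP.Worm.{u},
      IsLUB {γ : Ordinal.{u} | ∃ B : TransfiniteGLP.Worm.{u},
          TransfiniteGLP.LT ξ B A ∧ γ = TransfiniteGLP.Omega ξ B + 1}
        (TransfiniteGLP.Omega ξ A)) ∧
    (∀ A : TransfiniteGLP.S ξ,
      IsLUB {γ : Ordinal.{u} | ∃ B : TransfiniteGLP.S ξ,
          TransfiniteGLP.LTS ξ B A ∧ γ = TransfiniteGLP.o ξ B + 1}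
        (TransfiniteGLP.o ξ A)) ∧
    ∀ A : TransfiniteGLP.Worm.{u},
      TransfiniteGLP.Omega ξ A =
        TransfiniteGLP.o ξ ⟨TransfiniteGLP.head ξ A, TransfiniteGLP.head_mem ξ A⟩ :=
  ⟨TransfiniteGLP.wellFounded_LT ξ, TransfiniteGLP.wellFounded_LTS ξ,
    TransfiniteGLP.isLUB_Omega ξ, TransfiniteGLP.isLUB_o ξ, TransfiniteGLP.Omega_eq_o_head ξ⟩
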